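/- Let $Q=(q_{ij})_{i,j\ge 0}$ be a real matrix such that, for every $i\ge 0$, $q_{i,i+1}>0$, $q_{ij}=0$ for $j>i+1$, and $\sum_{j=0}^{i+1}q_{ij}=0$. Let $(X_t)_{t\ge 0}$ be a right-continuous Markov process on $\{0,1,2,\dots\}$ with generator $Q$, started at $0$: there is a transition function $(P_t)_{t\ge0}$ (a semigroup of nonnegative matrices with row sums at most one, $P_0=I$) with entrywise right derivative $Q$ at $t=0$ such that, given the past of $X$ up to time $s$ and $X_s=i$, the probability that $X_{s+t}=j$ is $P_t(i,j)$. (The process may explode; at times when it is not in $\{0,1,2,\dots\}$ it takes an extra value $\infty$, the point at infinity of the one-point compactification.) For $n\ge 0$ let $Q_n=(q_{ij})_{0\le i,j\le n-1}$ be the upper left $n\times n$ block of $Q$, let $T_n=\inf\{t\ge 0: X_t=n\}$, and for $0\le i\le n-1$ let $l^i_{T_n}=\int_0^{T_n}\mathbf 1_{\{X_s=i\}}\,ds$ be the time spent in state $i$ before reaching $n$. Then $T_n<\infty$ and all $l^i_{T_n}<\infty$ almost surely, and for all $d_0,\dots,d_{n-1}\ge 0$, with $D=\operatorname{diag}(d_0,\dots,d_{n-1})$,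 the variable $e^{-\sum_i d_i l^i_{T_n}}$ is integrable, $\det(D-Q_n)\neq 0$, and $$\mathbf E_0\Big[e^{-\sum_{i=0}^{n-1} d_i\, l^i_{T_n}}\Big]=\frac{\det(-Q_n)}{\det(D-Q_n)}.$$ -/

import Mathlib

open MeasureTheory Filter Topology
open scoped NNReal ENNReal

namespace SkipFree

/-- The matrix condition: `q i (i+1) > 0`, `q i j = 0` for `j > i + 1`, and the `i`-th row, whose
entries vanish beyond column `i + 1`, sums to zero. -/
structure IsSkipFree (Q : Matrix ℕ ℕ ℝ) : Prop where
  up_pos : ∀ i, 0 < Q i (i + 1)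
  eq_zero : ∀ i j, i + 1 < j → Q i j = 0
  row_sum : ∀ i, ∑ j ∈ Finset.range (i + 2), Q i j = 0

/-- `P` is a transition function on `ℕ` with generator (`Q`-matrix) `Q`: a semigroup of
nonnegative matrices with row sums at most one (less than one if mass is lost by explosion)
and `P 0 = 1`, whose entrywise right derivative at time zero is `Q`. -/
structure IsTransitionFunction (P : ℝ≥0 → Matrix ℕ ℕ ℝ) (Q : Matrix ℕ ℕ ℝ) : Prop where
  nonneg : ∀ t i j, 0 ≤ P t i j
  summable : ∀ t i, Summable (P t i)
  row_sum_le : ∀ t i, ∑' j, P t i j ≤ 1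
  zero : P 0 = 1
  semigroup : ∀ s t i j, P (s + t) i j = ∑' k, P s i k * P t k j
  generator : ∀ i j, Tendsto (fun t : ℝ≥0 => (P t i j - P 0 i j) / (t : ℝ)) (𝓝[>] 0)
    (𝓝 (Q i j))

/-- The `σ`-algebra generated by the process `X` up to time `s`. -/
@[reducible]
def past {Ω : Type*} (X : ℝ≥0 → Ω → ℕ∞) (s : ℝ≥0) : MeasurableSpace Ω :=
  ⨆ r : Set.Iic s, MeasurableSpace.comap (X r) inferInstance

/-- `X` is, under `μ`, a continuous-time Markov process on `ℕ` with generator `Q`, started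
at `x`. The paths are right-continuous, and given the past up to time `s` and `X s = i`, the
probability of `X (s + t) = j` is `P t i j`, for a transition function `P` with generator `Q`.
The extra value `⊤` (the point at infinity of the compactification `ℕ∞` of `ℕ`) is only there for
processes that explode; a process which never explodes does not take it. -/
structure IsMarkovProcess {Ω : Type*} [MeasurableSpace Ω] (μ : Measure Ω)
    (X : ℝ≥0 → Ω → ℕ∞) (Q : Matrix ℕ ℕ ℝ) (x : ℕ) : Prop where
  measurable : ∀ t, Measurable (X t)
  start : ∀ᵐ ω ∂μ, X 0 ω = x
  rightContinuous : ∀ᵐ ω ∂μ, ∀ t, ContinuousWithinAt (fun s => X s ω) (Set.Ici t) t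
  markov : ∃ P : ℝ≥0 → Matrix ℕ ℕ ℝ, IsTransitionFunction P Q ∧
    ∀ (s t : ℝ≥0) (i j : ℕ) (A : Set Ω), MeasurableSet[past X s] A →
      μ (A ∩ {ω | X s ω = i} ∩ {ω | X (s + t) ω = j}) =
        μ (A ∩ {ω | X s ω = i}) * ENNReal.ofReal (P t i j)

/-- The first time (possibly infinite) at which `X` is in the state `n`. -/
noncomputable def hittingTime {Ω : Type*} (X : ℝ≥0 → Ω → ℕ∞) (n : ℕ) (ω : Ω) : ℝ≥0∞ :=
  ⨅ (t : ℝ≥0) (_ : X t ω = n), (t : ℝ≥0∞)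

/-- The amount of time spent by `X` in the state `i` before time `T`. -/
noncomputable def occupationTime {Ω : Type*} (X : ℝ≥0 → Ω → ℕ∞) (i : ℕ) (T : ℝ≥0∞) (ω : Ω) :
    ℝ≥0∞ :=
  ∫⁻ s in {s : ℝ | 0 ≤ s ∧ ENNReal.ofReal s < T}, Set.indicator {s | X s.toNNReal ω = i} 1 s

/-- The upper left `n × n` block of `Q`. -/
def upperBlock (Q : Matrix ℕ ℕ ℝ) (n : ℕ) : Matrix (Fin n) (Fin n) ℝ :=
  Q.submatrix (fun i => (i : ℕ)) (fun j => (j : ℕ))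

end SkipFree

/-!
Observe `X` at the multiples of `h` and kill it at rate `d i` while it is in `i < n`. If `A` is the
killed one-step matrix on `{0, …, n - 1}` and `b` its column of transitions to `n`, then the
probabilities `v = ∑ₘ Aᵐ b` of being at `n` when first observed outside `{0, …, n - 1}` solve
`(1 - A) v = b`. Dividing by `h` and letting `h → 0`, Cramer's rule says that `det (D - Qₙ)` times
the limit of `v` is the vector of determinants of `D - Qₙ` with one column replaced by the rates of
the transitions to `n`. For the column `0` the skip-free condition makes this determinant triangular
up to a cyclic permutation of the columns: it is `∏ q_{i,i+1}`, whatever `D` is.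

Since the rows of `Q` sum to zero, the rates of the transitions to `n` are `-Qₙ 1`, so for `D = 0`
all these determinants are `det (-Qₙ)`. Hence `v → 1` when nothing is killed, that is, `n` is
reached almost surely, and `∏ q_{i,i+1} = det (-Qₙ)`.

Rounding times up to the grid evaluates the path at right end points, so right continuity alone
makes the grid sums converge to occupation times.
-/

namespace SkipFree

section CramerResolvent

variable {ι R : Type*} [Fintype ι] [DecidableEq ι]

theorem pow_mulVec_nonneg [Semiring R] [PartialOrder R] [IsOrderedRing R] {A : Matrix ι ι R}
    {b : ι → R} (hA : ∀ i j, 0 ≤ A i j) (hb : ∀ i, 0 ≤ b i) (m : ℕ) (i : ι) :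
    0 ≤ (A ^ m).mulVec b i :=
  Finset.sum_nonneg fun j _ => mul_nonneg (Matrix.pow_apply_nonneg hA m i j) (hb j)

theorem sum_range_pow_mulVec_le_one [Semiring R] [PartialOrder R] [IsOrderedRing R]
    {A : Matrix ι ι R} {b : ι → R} (hA : ∀ i j, 0 ≤ A i j)
    (hrow : ∀ i, b i + ∑ j, A i j ≤ 1) (M : ℕ) (i : ι) :
    ∑ m ∈ Finset.range M, (A ^ m).mulVec b i ≤ 1 := by
  induction M generalizing i with
  | zero => simp
  | succ M ih =>
    calc ∑ m ∈ Finset.range (M + 1), (A ^ m).mulVec b i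
        = b i + ∑ j, A i j * ∑ m ∈ Finset.range M, (A ^ m).mulVec b j := by
          simp only [Finset.sum_range_succ', pow_succ', ← Matrix.mulVec_mulVec, pow_zero,
            Matrix.one_mulVec, Finset.mul_sum]
          rw [Finset.sum_comm, add_comm]
          rfl
      _ ≤ b i + ∑ j, A i j := by
          gcongr with j
          exact mul_le_of_le_one_right (hA i j) (ih j)
      _ ≤ 1 := hrow i

theorem summable_pow_mulVec {A : Matrix ι ι ℝ} {b : ι → ℝ} (hA : ∀ i j, 0 ≤ A i j)
    (hb : ∀ i, 0 ≤ b i) (hrow : ∀ i, b i + ∑ j, A i j ≤ 1) :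
    Summable fun m : ℕ => (A ^ m).mulVec b :=
  Pi.summable.2 fun i => summable_of_sum_range_le (fun m => pow_mulVec_nonneg hA hb m i)
    fun M => sum_range_pow_mulVec_le_one hA hrow M i

theorem one_sub_mulVec_tsum_pow_mulVec [CommRing R] [TopologicalSpace R] [IsTopologicalRing R]
    [T2Space R] {A : Matrix ι ι R} {b : ι → R} (hs : Summable fun m : ℕ => (A ^ m).mulVec b) :
    (1 - A).mulVec (∑' m : ℕ, (A ^ m).mulVec b) = b := by
  have hshift : A.mulVec (∑' m : ℕ, (A ^ m).mulVec b) = ∑' m : ℕ, (A ^ (m + 1)).mulVec b := by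
    simp only [pow_succ', ← Matrix.mulVec_mulVec]
    exact hs.map_tsum A.mulVecLin (continuous_const.matrix_mulVec continuous_id)
  rw [Matrix.sub_mulVec, Matrix.one_mulVec, hshift, hs.tsum_eq_zero_add, pow_zero,
    Matrix.one_mulVec, add_sub_cancel_right]

theorem det_mul_eq_cramer_of_tendsto [CommRing R] [TopologicalSpace R] [IsTopologicalRing R]
    [T2Space R] {α : Type*} {l : Filter α} [l.NeBot] {B : α → Matrix ι ι R} {v c : α → ι → R}
    {B₀ : Matrix ι ι R} {c₀ : ι → R} {i : ι} {L : R}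
    (hBv : ∀ a, (B a).mulVec (v a) = c a) (hB : Tendsto B l (𝓝 B₀)) (hc : Tendsto c l (𝓝 c₀))
    (hv : Tendsto (fun a => v a i) l (𝓝 L)) : B₀.det * L = B₀.cramer c₀ i := by
  have hdet : Tendsto (fun a => (B a).det * v a i) l (𝓝 (B₀.det * L)) :=
    ((continuous_id.matrix_det.tendsto B₀).comp hB).mul hv
  have hcramer : Tendsto (fun a => (B a).cramer (c a) i) l (𝓝 (B₀.cramer c₀ i)) := by
    simp only [Matrix.cramer_apply]
    exact (continuous_id.matrix_det.tendsto _).comp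
      (((continuous_fst.matrix_updateCol i continuous_snd).tendsto (B₀, c₀)).comp
        (hB.prodMk_nhds hc))
  refine tendsto_nhds_unique hdet (hcramer.congr fun a => ?_)
  rw [← hBv a, Matrix.cramer_eq_adjugate_mulVec, Matrix.mulVec_mulVec, Matrix.adjugate_mul,
    Matrix.smul_mulVec, Matrix.one_mulVec, Pi.smul_apply, smul_eq_mul]

end CramerResolvent

/-- The entries of the rows `i < n` of `Q` in the column `n`: the rates of the transitions from
`{0, …, n - 1}` to `n`, when `Q` is a generator. -/
def exitRate (Q : Matrix ℕ ℕ ℝ) (n : ℕ) : Fin n → ℝ := fun i => Q i n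

section IsSkipFree

variable {Q : Matrix ℕ ℕ ℝ}

theorem IsSkipFree.cramer_diagonal_sub_upperBlock_zero (hQ : IsSkipFree Q) {N : ℕ}
    (d : Fin (N + 1) → ℝ) :
    (Matrix.diagonal d - upperBlock Q (N + 1)).cramer (exitRate Q (N + 1)) 0 =
      ∏ i ∈ Finset.range (N + 1), Q i (i + 1) := by
  have hminor : ((Matrix.diagonal d - upperBlock Q (N + 1)).submatrix
      Fin.castSucc Fin.succ).det = ∏ i : Fin N, -Q i (i + 1) := by
    have hentry (i j : Fin N) : (Matrix.diagonal d - upperBlock Q (N + 1)).submatrix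
        Fin.castSucc Fin.succ i j =
          (if (i : ℕ) = j + 1 then d i.castSucc else 0) - Q i (j + 1) := by
      simp [Matrix.diagonal_apply, upperBlock, Fin.ext_iff]
    rw [Matrix.det_of_isLowerTriangular _ fun i j (hij : i < j) => ?_]
    · simp only [hentry, Nat.left_eq_add, one_ne_zero, if_false, zero_sub]
    · rw [hentry, if_neg (by omega), hQ.eq_zero _ _ (by omega), sub_zero]
  have hexit (i : Fin N) : exitRate Q (N + 1) i.castSucc = 0 := hQ.eq_zero _ _ (by simp)
  rw [Matrix.cramer_apply, Matrix.det_succ_column_zero, Fin.sum_univ_castSucc]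
  simp only [Matrix.updateCol_self, hexit, mul_zero, zero_mul, Finset.sum_const_zero, zero_add]
  rw [← Fin.succAbove_zero, Matrix.submatrix_updateCol_succAbove, Fin.succAbove_last,
    Fin.succAbove_zero, hminor, Finset.prod_neg, Finset.prod_range_succ, Finset.prod_range]
  simp only [Finset.card_univ, Fintype.card_fin, exitRate, Fin.val_last]
  rw [mul_mul_mul_comm, ← pow_add, Even.neg_one_pow ⟨N, rfl⟩, one_mul, mul_comm]

theorem IsSkipFree.neg_upperBlock_mulVec_one (hQ : IsSkipFree Q) (n : ℕ) :
    (-upperBlock Q n).mulVec 1 = exitRate Q n := by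
  ext i
  have hrow : ∑ j ∈ Finset.range (n + 1), Q i j = 0 := by
    rw [← hQ.row_sum i]
    symm
    refine Finset.sum_subset (Finset.range_subset_range.2 (by omega)) fun j _ hj => ?_
    rw [Finset.mem_range] at hj
    exact hQ.eq_zero _ _ (by omega)
  rw [Finset.sum_range_succ, Finset.sum_range] at hrow
  simp only [Matrix.mulVec, dotProduct, upperBlock, exitRate, Matrix.neg_apply,
    Matrix.submatrix_apply, Pi.one_apply, mul_one, Finset.sum_neg_distrib]
  linarith

theorem IsSkipFree.cramer_neg_upperBlock (hQ : IsSkipFree Q) {n : ℕ} (i : Fin n) :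
    (-upperBlock Q n).cramer (exitRate Q n) i = (-upperBlock Q n).det := by
  rw [← hQ.neg_upperBlock_mulVec_one, Matrix.cramer_eq_adjugate_mulVec, Matrix.mulVec_mulVec,
    Matrix.adjugate_mul, Matrix.smul_mulVec, Matrix.one_mulVec]
  simp

theorem IsSkipFree.det_neg_upperBlock (hQ : IsSkipFree Q) (n : ℕ) :
    (-upperBlock Q n).det = ∏ i ∈ Finset.range n, Q i (i + 1) := by
  cases n with
  | zero => simp
  | succ N =>
    rw [← hQ.cramer_neg_upperBlock 0, ← hQ.cramer_diagonal_sub_upperBlock_zero 0,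
      Matrix.diagonal_zero', zero_sub]

theorem IsSkipFree.det_neg_upperBlock_pos (hQ : IsSkipFree Q) (n : ℕ) :
    0 < (-upperBlock Q n).det := by
  rw [hQ.det_neg_upperBlock]
  exact Finset.prod_pos fun i _ => hQ.up_pos i

end IsSkipFree

section KilledKernel

variable {n : ℕ} {P : ℝ≥0 → Matrix ℕ ℕ ℝ} {Q : Matrix ℕ ℕ ℝ}

/-- The one-step kernel of the chain observed at the multiples of `h`, started in `{0, …, n - 1}`
and killed at rate `d i` while in `i`: the survival probability of a step from `i` is
`exp (-(d i * h))`. -/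
noncomputable def killedKernel (P : ℝ≥0 → Matrix ℕ ℕ ℝ) (d : Fin n → ℝ) (h : ℝ≥0) :
    Matrix (Fin n) ℕ ℝ :=
  Matrix.of fun i j => Real.exp (-(d i * h)) * P h i j

/-- The restriction of `killedKernel P d h` to `{0, …, n - 1}`. -/
noncomputable def killedMatrix (P : ℝ≥0 → Matrix ℕ ℕ ℝ) (d : Fin n → ℝ) (h : ℝ≥0) :
    Matrix (Fin n) (Fin n) ℝ :=
  (killedKernel P d h).submatrix id Fin.val

/-- The column `n` of `killedKernel P d h`: surviving one step and being in `n` afterwards. -/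
noncomputable def killedExit (P : ℝ≥0 → Matrix ℕ ℕ ℝ) (d : Fin n → ℝ) (h : ℝ≥0) : Fin n → ℝ :=
  fun i => killedKernel P d h i n

theorem killedKernel_nonneg (hP : IsTransitionFunction P Q) (d : Fin n → ℝ) (h : ℝ≥0) (i j) :
    0 ≤ killedKernel P d h i j :=
  mul_nonneg (Real.exp_nonneg _) (hP.nonneg _ _ _)

theorem killedExit_add_sum_killedMatrix_le_one (hP : IsTransitionFunction P Q) {d : Fin n → ℝ}
    (hd : ∀ i, 0 ≤ d i) (h : ℝ≥0) (i : Fin n) :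
    killedExit P d h i + ∑ j, killedMatrix P d h i j ≤ 1 :=
  calc killedExit P d h i + ∑ j, killedMatrix P d h i j
      = Real.exp (-(d i * h)) * ∑ j ∈ Finset.range (n + 1), P h i j := by
        rw [Finset.sum_range_succ, Finset.sum_range, mul_add, Finset.mul_sum, add_comm]
        rfl
    _ ≤ ∑ j ∈ Finset.range (n + 1), P h i j :=
        mul_le_of_le_one_left (Finset.sum_nonneg fun j _ => hP.nonneg h i j)
          (Real.exp_le_one_iff.2 (neg_nonpos.2 (mul_nonneg (hd i) h.2)))
    _ ≤ ∑' j, P h i j := (hP.summable h i).sum_le_tsum _ fun j _ => hP.nonneg h i j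
    _ ≤ 1 := hP.row_sum_le h i

theorem tendsto_coe_nhdsGT_zero :
    Tendsto (fun h : ℝ≥0 => (h : ℝ)) (𝓝[>] 0) (𝓝[>] 0) :=
  tendsto_nhdsWithin_iff.2
    ⟨(NNReal.continuous_coe.tendsto' 0 0 rfl).mono_left nhdsWithin_le_nhds,
      eventually_nhdsWithin_of_forall fun _ => NNReal.coe_pos.2⟩

theorem tendsto_exp_neg_mul (c : ℝ) :
    Tendsto (fun t : ℝ => Real.exp (-(c * t))) (𝓝[>] 0) (𝓝 1) :=
  ((by fun_prop : Continuous fun t : ℝ => Real.exp (-(c * t))).tendsto' 0 1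
    (by simp)).mono_left nhdsWithin_le_nhds

theorem tendsto_inv_mul_one_sub_exp_neg_mul (c : ℝ) :
    Tendsto (fun t : ℝ => t⁻¹ * (1 - Real.exp (-(c * t)))) (𝓝[>] 0) (𝓝 c) := by
  have hderiv : HasDerivAt (fun t : ℝ => 1 - Real.exp (-(c * t))) c 0 := by
    simpa using (((hasDerivAt_id (0 : ℝ)).const_mul c).neg.exp).const_sub 1
  simpa using hderiv.tendsto_slope_zero_right

theorem tendsto_killedKernel (hP : IsTransitionFunction P Q) (d : Fin n → ℝ) (i : Fin n) (j : ℕ) :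
    Tendsto (fun h : ℝ≥0 => (h : ℝ)⁻¹ * ((1 : Matrix ℕ ℕ ℝ) i j - killedKernel P d h i j))
      (𝓝[>] 0) (𝓝 (d i * (1 : Matrix ℕ ℕ ℝ) i j - Q i j)) := by
  have hkill := ((tendsto_inv_mul_one_sub_exp_neg_mul (d i)).comp
    tendsto_coe_nhdsGT_zero).mul_const ((1 : Matrix ℕ ℕ ℝ) i j)
  have hmove := ((tendsto_exp_neg_mul (d i)).comp tendsto_coe_nhdsGT_zero).mul (hP.generator i j)
  rw [one_mul] at hmove
  refine (hkill.sub hmove).congr fun h => ?_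
  simp only [Function.comp_apply, hP.zero, killedKernel, Matrix.of_apply]
  ring

theorem tendsto_one_sub_killedMatrix (hP : IsTransitionFunction P Q) (d : Fin n → ℝ) :
    Tendsto (fun h : ℝ≥0 => (h : ℝ)⁻¹ • (1 - killedMatrix P d h)) (𝓝[>] 0)
      (𝓝 (Matrix.diagonal d - upperBlock Q n)) := by
  refine tendsto_pi_nhds.2 fun i => tendsto_pi_nhds.2 fun j => ?_
  convert tendsto_killedKernel hP d i j using 2
  · simp [killedMatrix, Matrix.one_apply, Fin.ext_iff]
  · simp [upperBlock, Matrix.diagonal_apply, Matrix.one_apply, Fin.ext_iff]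

theorem tendsto_killedExit (hP : IsTransitionFunction P Q) (d : Fin n → ℝ) :
    Tendsto (fun h : ℝ≥0 => (h : ℝ)⁻¹ • killedExit P d h) (𝓝[>] 0) (𝓝 (exitRate Q n)) := by
  refine tendsto_pi_nhds.2 fun i => ?_
  simpa [killedExit, exitRate, Matrix.one_apply, i.2.ne] using (tendsto_killedKernel hP d i n).neg

theorem det_mul_eq_cramer_of_tendsto_tsum (hP : IsTransitionFunction P Q) {d : Fin n → ℝ}
    (hd : ∀ i, 0 ≤ d i) {i : Fin n} {L : ℝ}
    (hL : Tendsto (fun h => ∑' m : ℕ, (killedMatrix P d h ^ m).mulVec (killedExit P d h) i)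
      (𝓝[>] 0) (𝓝 L)) :
    (Matrix.diagonal d - upperBlock Q n).det * L =
      (Matrix.diagonal d - upperBlock Q n).cramer (exitRate Q n) i := by
  have hs (h : ℝ≥0) : Summable fun m : ℕ => (killedMatrix P d h ^ m).mulVec (killedExit P d h) :=
    summable_pow_mulVec (fun i j => killedKernel_nonneg hP d h i j)
      (fun i => killedKernel_nonneg hP d h i n) (killedExit_add_sum_killedMatrix_le_one hP hd h)
  refine det_mul_eq_cramer_of_tendsto (fun h => ?_) (tendsto_one_sub_killedMatrix hP d)
    (tendsto_killedExit hP d) (hL.congr fun h => (tsum_apply (hs h)).symm)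
  rw [Matrix.smul_mulVec, one_sub_mulVec_tsum_pow_mulVec (hs h)]

end KilledKernel

section GridFunctional

variable {n : ℕ} {d : Fin n → ℝ} {h : ℝ≥0} {y : ℝ≥0 → ℕ∞}

/-- The survival probability `exp (-(d i * h))` of a step of length `h` from a state `i < n`, and
`0` for the other states: the chain is also killed outside `{0, …, n - 1}`. -/
noncomputable def killedWeight (d : Fin n → ℝ) (h : ℝ≥0) (a : ℕ∞) : ℝ≥0∞ :=
  ∑ i : Fin n, if a = (i : ℕ) then ENNReal.ofReal (Real.exp (-(d i * h))) else 0

/-- The probability that a chain killed according to `killedWeight d h`, and following the path `y`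
at the multiples of `h`, survives its first `m` steps. -/
noncomputable def gridWeight (d : Fin n → ℝ) (h : ℝ≥0) (y : ℝ≥0 → ℕ∞) (m : ℕ) : ℝ≥0∞ :=
  ∏ k ∈ Finset.range m, killedWeight d h (y (k * h))

/-- The probability that a chain killed according to `killedWeight d h`, and following the path `y`
at the multiples of `h`, reaches `n`. At most one term of the sum is nonzero, since the chain is
killed in `n`. -/
noncomputable def gridFunctional (d : Fin n → ℝ) (h : ℝ≥0) (y : ℝ≥0 → ℕ∞) : ℝ≥0∞ :=
  ∑' m : ℕ, if y (m * h) = n then gridWeight d h y m else 0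

theorem killedWeight_coe (d : Fin n → ℝ) (h : ℝ≥0) (i : Fin n) :
    killedWeight d h (i : ℕ) = ENNReal.ofReal (Real.exp (-(d i * h))) := by
  simp [killedWeight, ← Fin.ext_iff]

theorem killedWeight_of_le {a : ℕ∞} (ha : n ≤ a) : killedWeight d h a = 0 := by
  refine Finset.sum_eq_zero fun i _ => if_neg ?_
  rintro rfl
  exact absurd (Nat.cast_le.1 ha) i.2.not_ge

theorem exists_fin_eq_of_lt {a : ℕ∞} (ha : a < n) : ∃ i : Fin n, a = (i : ℕ) := by
  lift a to ℕ using ne_top_of_lt ha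
  exact ⟨⟨a, Nat.cast_lt.1 ha⟩, rfl⟩

theorem killedWeight_le_one (hd : ∀ i, 0 ≤ d i) (a : ℕ∞) : killedWeight d h a ≤ 1 := by
  rcases lt_or_ge a n with ha | ha
  · obtain ⟨i, rfl⟩ := exists_fin_eq_of_lt ha
    rw [killedWeight_coe, ENNReal.ofReal_le_one, Real.exp_le_one_iff, neg_nonpos]
    exact mul_nonneg (hd i) h.2
  · simp [killedWeight_of_le ha]

theorem gridWeight_succ (d : Fin n → ℝ) (h : ℝ≥0) (y : ℝ≥0 → ℕ∞) (m : ℕ) :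
    gridWeight d h y (m + 1) = gridWeight d h y m * killedWeight d h (y (m * h)) :=
  Finset.prod_range_succ _ _

theorem gridWeight_eq_zero {k m : ℕ} (hk : n ≤ y (k * h)) (hkm : k < m) :
    gridWeight d h y m = 0 :=
  Finset.prod_eq_zero (Finset.mem_range.2 hkm) (killedWeight_of_le hk)

theorem sum_range_add_gridWeight_le_one (hd : ∀ i, 0 ≤ d i) (M : ℕ) :
    ∑ m ∈ Finset.range M, (if y (m * h) = n then gridWeight d h y m else 0) +
      gridWeight d h y M ≤ 1 := by
  induction M with
  | zero => simp [gridWeight]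
  | succ M ih =>
    refine le_trans ?_ ih
    rw [Finset.sum_range_succ, add_assoc, gridWeight_succ]
    gcongr
    split_ifs with hM
    · rw [killedWeight_of_le hM.ge, mul_zero, add_zero]
    · rw [zero_add]
      exact mul_le_of_le_one_right' (killedWeight_le_one hd _)

theorem gridFunctional_le_one (hd : ∀ i, 0 ≤ d i) : gridFunctional d h y ≤ 1 :=
  ENNReal.tsum_le_of_sum_range_le fun M =>
    le_self_add.trans (sum_range_add_gridWeight_le_one hd M)

theorem gridFunctional_eq_ite_of_exit {M : ℕ} (hlt : ∀ k < M, y (k * h) < n)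
    (hexit : n ≤ y (M * h)) :
    gridFunctional d h y = if y (M * h) = n then gridWeight d h y M else 0 := by
  refine tsum_eq_single M fun k hk => ?_
  rcases lt_or_gt_of_ne hk with hk | hk
  · exact if_neg (hlt k hk).ne
  · rw [gridWeight_eq_zero hexit hk, ite_self]

theorem gridFunctional_eq_zero (hlt : ∀ t, y t < n) : gridFunctional d h y = 0 :=
  ENNReal.tsum_eq_zero.2 fun _ => if_neg (hlt _).ne

end GridFunctional

section MarkovProperty

variable {Ω : Type*} {X : ℝ≥0 → Ω → ℕ∞} {n : ℕ}

theorem measurable_past {r s : ℝ≥0} (hrs : r ≤ s) : Measurable[past X s] (X r) :=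
  Measurable.mono (comap_measurable (X r))
    (le_iSup (fun r : Set.Iic s => MeasurableSpace.comap (X r) inferInstance) ⟨r, hrs⟩) le_rfl

theorem measurable_past_gridWeight (d : Fin n → ℝ) (h : ℝ≥0) (m : ℕ) :
    Measurable[past X (m * h)] fun ω => gridWeight d h (X · ω) m := by
  refine Finset.measurable_fun_prod _ fun k hk => ?_
  refine (Measurable.of_discrete (f := killedWeight d h)).comp (measurable_past ?_)
  have hkm : k ≤ m := (Finset.mem_range.1 hk).le
  gcongr

variable [mΩ : MeasurableSpace Ω] {μ : Measure Ω}

/-- The Markov property of `X` under `μ` with transition function `P`, in the form in which it is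
part of `IsMarkovProcess`. -/
def MarkovProperty (μ : Measure Ω) (X : ℝ≥0 → Ω → ℕ∞) (P : ℝ≥0 → Matrix ℕ ℕ ℝ) : Prop :=
  ∀ (s t : ℝ≥0) (i j : ℕ) (A : Set Ω), MeasurableSet[past X s] A →
    μ (A ∩ {ω | X s ω = i} ∩ {ω | X (s + t) ω = j}) =
      μ (A ∩ {ω | X s ω = i}) * ENNReal.ofReal (P t i j)

theorem past_le (hX : ∀ t, Measurable (X t)) (s : ℝ≥0) : past X s ≤ mΩ :=
  iSup_le fun r => (hX r).comap_le

theorem measurableSet_eq_coe (hX : ∀ t, Measurable (X t)) (t : ℝ≥0) (j : ℕ) :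
    MeasurableSet {ω | X t ω = j} :=
  hX t (MeasurableSet.of_discrete (s := {(j : ℕ∞)}))

theorem measurable_gridWeight (hX : ∀ t, Measurable (X t)) (d : Fin n → ℝ) (h : ℝ≥0) (m : ℕ) :
    Measurable fun ω => gridWeight d h (X · ω) m :=
  (measurable_past_gridWeight d h m).mono (past_le hX _) le_rfl

theorem measurable_gridFunctional (hX : ∀ t, Measurable (X t)) (d : Fin n → ℝ) (h : ℝ≥0) :
    Measurable fun ω => gridFunctional d h (X · ω) :=
  Measurable.tsum fun m => Measurable.ite (measurableSet_eq_coe hX _ _)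
    (measurable_gridWeight hX d h m) measurable_const

variable {P : ℝ≥0 → Matrix ℕ ℕ ℝ}

theorem MarkovProperty.setLIntegral_inter (hM : MarkovProperty μ X P)
    (hX : ∀ t, Measurable (X t)) (s t : ℝ≥0) (i j : ℕ) {f : Ω → ℝ≥0∞}
    (hf : Measurable[past X s] f) :
    ∫⁻ ω in {ω | X s ω = i} ∩ {ω | X (s + t) ω = j}, f ω ∂μ =
      (∫⁻ ω in {ω | X s ω = i}, f ω ∂μ) * ENNReal.ofReal (P t i j) := by
  have hm := past_le hX s
  rw [← lintegral_trim hm hf, ← lintegral_trim hm hf, mul_comm, ← smul_eq_mul,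
    ← lintegral_smul_measure]
  congr 1
  refine @Measure.ext _ (past X s) _ _ fun A hA => ?_
  rw [Measure.smul_apply, trim_measurableSet_eq hm hA, trim_measurableSet_eq hm hA,
    Measure.restrict_apply (hm _ hA), Measure.restrict_apply (hm _ hA), ← Set.inter_assoc,
    hM s t i j A hA, smul_eq_mul, mul_comm]

theorem MarkovProperty.setLIntegral_gridWeight_succ (hM : MarkovProperty μ X P)
    (hX : ∀ t, Measurable (X t)) (d : Fin n → ℝ) (h : ℝ≥0) (m j : ℕ) :
    ∫⁻ ω in {ω | X ((m + 1 : ℕ) * h) ω = j}, gridWeight d h (X · ω) (m + 1) ∂μ =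
      ∑ i : Fin n, (∫⁻ ω in {ω | X (m * h) ω = (i : ℕ)}, gridWeight d h (X · ω) m ∂μ) *
        ENNReal.ofReal (killedKernel P d h i j) := by
  have htime : ((m + 1 : ℕ) : ℝ≥0) * h = m * h + h := by push_cast; ring
  have hsplit (ω : Ω) : gridWeight d h (X · ω) (m + 1) =
      ∑ i : Fin n, {ω | X (m * h) ω = (i : ℕ)}.indicator (fun ω => gridWeight d h (X · ω) m) ω *
        ENNReal.ofReal (Real.exp (-(d i * h))) := by
    simp only [gridWeight_succ, killedWeight, Finset.mul_sum, Set.indicator_apply,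
      Set.mem_ofPred_eq, mul_ite, ite_mul, mul_zero, zero_mul]
  have hterm (i : Fin n) := (measurable_gridWeight hX d h m).indicator
    (measurableSet_eq_coe hX (m * h) i)
  simp_rw [hsplit]
  rw [lintegral_finsetSum _ fun i _ => (hterm i).mul_const _]
  refine Finset.sum_congr rfl fun i _ => ?_
  rw [lintegral_mul_const _ (hterm i), lintegral_indicator (measurableSet_eq_coe hX _ _),
    Measure.restrict_restrict (measurableSet_eq_coe hX _ _), htime,
    hM.setLIntegral_inter hX _ _ _ _ (measurable_past_gridWeight d h m), killedKernel,
    Matrix.of_apply, ENNReal.ofReal_mul (Real.exp_nonneg _), mul_assoc, mul_comm (ENNReal.ofReal _)]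

variable [IsProbabilityMeasure μ] {Q : Matrix ℕ ℕ ℝ} {x : Fin n}

theorem MarkovProperty.setLIntegral_gridWeight (hM : MarkovProperty μ X P)
    (hP : IsTransitionFunction P Q) (hX : ∀ t, Measurable (X t))
    (hstart : ∀ᵐ ω ∂μ, X 0 ω = (x : ℕ)) (d : Fin n → ℝ) (h : ℝ≥0) (m : ℕ) (j : Fin n) :
    ∫⁻ ω in {ω | X (m * h) ω = (j : ℕ)}, gridWeight d h (X · ω) m ∂μ =
      ENNReal.ofReal ((killedMatrix P d h ^ m) x j) := by
  have hA : ∀ i j, 0 ≤ killedMatrix P d h i j := fun i j => killedKernel_nonneg hP d h i j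
  induction m generalizing j with
  | zero =>
    have hone : {ω | X 0 ω = (j : ℕ)} =ᵐ[μ] {_ω | x = j} := by
      filter_upwards [hstart] with ω hω
      change (X 0 ω = (j : ℕ)) = (x = j)
      rw [hω, Nat.cast_inj, ← Fin.ext_iff]
    simp only [Nat.cast_zero, zero_mul, gridWeight, Finset.range_zero, Finset.prod_empty,
      setLIntegral_one, measure_congr hone, pow_zero, Matrix.one_apply]
    by_cases hxj : x = j <;> simp [hxj]
  | succ m ih =>
    rw [hM.setLIntegral_gridWeight_succ hX, pow_succ, Matrix.mul_apply,
      ENNReal.ofReal_sum_of_nonneg fun i _ =>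
        mul_nonneg (Matrix.pow_apply_nonneg hA m x i) (hA i j)]
    refine Finset.sum_congr rfl fun i _ => ?_
    rw [ih, ENNReal.ofReal_mul (Matrix.pow_apply_nonneg hA m x i)]
    rfl

theorem MarkovProperty.setLIntegral_gridWeight_exit (hM : MarkovProperty μ X P)
    (hP : IsTransitionFunction P Q) (hX : ∀ t, Measurable (X t))
    (hstart : ∀ᵐ ω ∂μ, X 0 ω = (x : ℕ)) (d : Fin n → ℝ) (h : ℝ≥0) (m : ℕ) :
    ∫⁻ ω in {ω | X ((m + 1 : ℕ) * h) ω = n}, gridWeight d h (X · ω) (m + 1) ∂μ =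
      ENNReal.ofReal ((killedMatrix P d h ^ m).mulVec (killedExit P d h) x) := by
  have hpow := Matrix.pow_apply_nonneg
    (show ∀ i j, 0 ≤ killedMatrix P d h i j from fun i j => killedKernel_nonneg hP d h i j) m x
  have hexit (i : Fin n) : 0 ≤ killedExit P d h i := killedKernel_nonneg hP d h i n
  rw [hM.setLIntegral_gridWeight_succ hX, Matrix.mulVec, dotProduct,
    ENNReal.ofReal_sum_of_nonneg fun i _ => mul_nonneg (hpow i) (hexit i)]
  refine Finset.sum_congr rfl fun i _ => ?_
  rw [hM.setLIntegral_gridWeight hP hX hstart, ENNReal.ofReal_mul (hpow i)]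
  rfl

theorem MarkovProperty.toReal_lintegral_gridFunctional (hM : MarkovProperty μ X P)
    (hP : IsTransitionFunction P Q) (hX : ∀ t, Measurable (X t))
    (hstart : ∀ᵐ ω ∂μ, X 0 ω = (x : ℕ)) (d : Fin n → ℝ) (h : ℝ≥0) :
    (∫⁻ ω, gridFunctional d h (X · ω) ∂μ).toReal =
      ∑' m : ℕ, (killedMatrix P d h ^ m).mulVec (killedExit P d h) x := by
  have hnonneg (m : ℕ) : 0 ≤ (killedMatrix P d h ^ m).mulVec (killedExit P d h) x :=
    pow_mulVec_nonneg (fun i j => killedKernel_nonneg hP d h i j)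
      (fun i => killedKernel_nonneg hP d h i n) m x
  have hterm (m : ℕ) : ∫⁻ ω, (if X (m * h) ω = n then gridWeight d h (X · ω) m else 0) ∂μ =
      ∫⁻ ω in {ω | X (m * h) ω = n}, gridWeight d h (X · ω) m ∂μ := by
    rw [← lintegral_indicator (measurableSet_eq_coe hX _ _)]
    simp only [Set.indicator_apply, Set.mem_ofPred_eq]
  have hzero : ∫⁻ ω in {ω | X ((0 : ℕ) * h) ω = n}, gridWeight d h (X · ω) 0 ∂μ = 0 := by
    refine setLIntegral_measure_zero _ _ ?_
    rw [Nat.cast_zero, zero_mul]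
    refine measure_mono_null (t := {ω | ¬ X 0 ω = (x : ℕ)}) (fun ω hω hx => ?_) hstart
    exact x.2.ne (Nat.cast_injective (R := ℕ∞) (hx.symm.trans hω))
  simp only [gridFunctional]
  rw [lintegral_tsum fun m => (Measurable.ite (measurableSet_eq_coe hX _ _)
    (measurable_gridWeight hX d h m) measurable_const).aemeasurable]
  simp only [hterm]
  rw [tsum_eq_zero_add' ENNReal.summable, hzero, zero_add]
  simp only [hM.setLIntegral_gridWeight_exit hP hX hstart]
  rw [ENNReal.tsum_toReal_eq fun m => ENNReal.ofReal_ne_top]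
  exact tsum_congr fun m => ENNReal.toReal_ofReal (hnonneg m)

end MarkovProperty

section RiemannSum

theorem tendsto_ceil_div_mul {K : Type*} [Semifield K] [LinearOrder K] [IsStrictOrderedRing K]
    [FloorSemiring K] [TopologicalSpace K] [OrderTopology K] [ContinuousAdd K] {t : K}
    (ht : 0 ≤ t) :
    Tendsto (fun h => (⌈t / h⌉₊ : K) * h) (𝓝[>] 0) (𝓝[≥] t) := by
  have hge : ∀ᶠ h : K in 𝓝[>] 0, t ≤ (⌈t / h⌉₊ : K) * h := by
    filter_upwards [self_mem_nhdsWithin] with h (hh : 0 < h)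
    exact (div_le_iff₀ hh).1 (Nat.le_ceil _)
  have hle : ∀ᶠ h : K in 𝓝[>] 0, (⌈t / h⌉₊ : K) * h ≤ t + h := by
    filter_upwards [self_mem_nhdsWithin] with h (hh : 0 < h)
    calc (⌈t / h⌉₊ : K) * h ≤ (t / h + 1) * h := by
          gcongr
          exact (Nat.ceil_lt_add_one (div_nonneg ht hh.le)).le
      _ = t + h := by rw [add_mul, div_mul_cancel₀ _ hh.ne', one_mul]
  have hadd : Tendsto (fun h => t + h) (𝓝[>] 0) (𝓝 t) :=
    ((continuous_const.add continuous_id).tendsto' 0 t (add_zero t)).mono_left nhdsWithin_le_nhds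
  exact tendsto_nhdsWithin_iff.2
    ⟨tendsto_of_tendsto_of_tendsto_of_le_of_le' tendsto_const_nhds hadd hge hle, hge⟩

theorem lintegral_Ioi_ceil_div {h : ℝ} (hh : 0 < h) (f : ℕ → ℝ≥0∞) :
    ∫⁻ s in Set.Ioi (-h), f ⌈s / h⌉₊ = ∑' k, f k * ENNReal.ofReal h := by
  have hceil : Measurable fun s : ℝ => ⌈s / h⌉₊ :=
    Nat.measurable_ceil.comp (measurable_id.div_const h)
  have hfiber (k : ℕ) : (fun s : ℝ => ⌈s / h⌉₊) ⁻¹' {k} ∩ Set.Ioi (-h) =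
      Set.Ioc ((k - 1) * h) (k * h) := by
    ext s
    rcases k with _ | k
    · simp [div_le_iff₀ hh, and_comm]
    · simp only [Set.mem_inter_iff, Set.mem_preimage, Set.mem_singleton_iff, Set.mem_Ioi,
        Nat.ceil_eq_iff (Nat.succ_ne_zero k), lt_div_iff₀ hh, div_le_iff₀ hh, Set.mem_Ioc]
      push_cast
      rw [add_sub_cancel_right, and_iff_left_iff_imp]
      have : 0 ≤ k * h := by positivity
      exact fun hs => by linarith [hs.1]
  rw [← lintegral_map (f := f) .of_discrete hceil, lintegral_countable']
  refine tsum_congr fun k => ?_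
  rw [Measure.map_apply hceil (measurableSet_singleton k),
    Measure.restrict_apply (hceil (measurableSet_singleton k)), hfiber, Real.volume_Ioc]
  congr 2
  ring

theorem tendsto_tsum_mul_setLIntegral_Ici {g : ℝ → ℝ≥0∞} {C : ℝ≥0∞} {σ : ℝ} (hC : C ≠ ∞)
    (hgC : ∀ s, g s ≤ C) (hgσ : ∀ s, σ ≤ s → g s = 0)
    (hg : ∀ s, 0 ≤ s → ContinuousWithinAt g (Set.Ici s) s) :
    Tendsto (fun h : ℝ => ∑' k : ℕ, g (k * h) * ENNReal.ofReal h) (𝓝[>] 0)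
      (𝓝 (∫⁻ s in Set.Ici 0, g s)) := by
  let F (h s : ℝ) : ℝ≥0∞ := (Set.Ioi (-h)).indicator (fun s => g (⌈s / h⌉₊ * h)) s
  have hsum : ∀ᶠ h : ℝ in 𝓝[>] 0, ∫⁻ s, F h s = ∑' k : ℕ, g (k * h) * ENNReal.ofReal h := by
    filter_upwards [self_mem_nhdsWithin] with h (hh : 0 < h)
    rw [lintegral_indicator measurableSet_Ioi, lintegral_Ioi_ceil_div hh fun k => g (k * h)]
  rw [← lintegral_indicator measurableSet_Ici]
  refine Tendsto.congr' hsum (tendsto_lintegral_filter_of_dominated_convergence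
    ((Set.Ioc (-1) σ).indicator fun _ => C) ?_ ?_ ?_ ?_)
  · refine Eventually.of_forall fun h => Measurable.indicator ?_ measurableSet_Ioi
    exact (Measurable.of_discrete (f := fun k : ℕ => g (k * h))).comp
      (Nat.measurable_ceil.comp (measurable_id.div_const h))
  · filter_upwards [Ioo_mem_nhdsGT one_pos] with h ⟨hh, h_lt⟩
    refine Eventually.of_forall fun s => Set.indicator_apply_le fun (hs : -h < s) => ?_
    rcases le_or_gt s σ with hsσ | hsσ
    · rw [Set.indicator_of_mem (show s ∈ Set.Ioc (-1) σ from ⟨by linarith, hsσ⟩)]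
      exact hgC _
    · rw [hgσ _ (hsσ.le.trans ((div_le_iff₀ hh).1 (Nat.le_ceil _)))]
      exact zero_le
  · rw [lintegral_indicator_const measurableSet_Ioc, Real.volume_Ioc]
    exact ENNReal.mul_ne_top hC ENNReal.ofReal_ne_top
  · refine Eventually.of_forall fun s => ?_
    rcases lt_or_ge s 0 with hs | hs
    · refine tendsto_nhds_of_eventually_eq ?_
      filter_upwards [Ioo_mem_nhdsGT (neg_pos.2 hs)] with h ⟨_, hhs⟩
      rw [Set.indicator_of_notMem (show s ∉ Set.Ici 0 from hs.not_ge)]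
      exact Set.indicator_of_notMem (fun hs' : -h < s => by linarith) _
    · rw [Set.indicator_of_mem (show s ∈ Set.Ici 0 from hs)]
      refine ((hg s hs).tendsto.comp (tendsto_ceil_div_mul hs)).congr' ?_
      filter_upwards [self_mem_nhdsWithin] with h (hh : 0 < h)
      have hmem : s ∈ Set.Ioi (-h) := (neg_neg_of_pos hh).trans_le hs
      exact (Set.indicator_of_mem hmem fun s => g (⌈s / h⌉₊ * h)).symm

theorem tendsto_sum_mul_setLIntegral_Ico {g : ℝ → ℝ≥0∞} {C : ℝ≥0∞} {σ : ℝ} (hC : C ≠ ∞)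
    (hgC : ∀ s, g s ≤ C) (hg : ∀ s ∈ Set.Ico 0 σ, ContinuousWithinAt g (Set.Ici s) s) :
    Tendsto (fun h : ℝ => ∑ k ∈ Finset.range ⌈σ / h⌉₊, g (k * h) * ENNReal.ofReal h) (𝓝[>] 0)
      (𝓝 (∫⁻ s in Set.Ico 0 σ, g s)) := by
  set f := (Set.Iio σ).indicator g with hf
  have hf_le (s : ℝ) : f s ≤ C := (Set.indicator_le_self (Set.Iio σ) g s).trans (hgC s)
  have hf_zero (s : ℝ) (hs : σ ≤ s) : f s = 0 := Set.indicator_of_notMem (Set.notMem_Iio.2 hs) g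
  have hf_eq (s : ℝ) (hs : s < σ) : f s = g s := Set.indicator_of_mem (Set.mem_Iio.2 hs) g
  have hf_cont (s : ℝ) (hs : 0 ≤ s) : ContinuousWithinAt f (Set.Ici s) s := by
    rcases lt_or_ge s σ with hsσ | hsσ
    · refine (hg s ⟨hs, hsσ⟩).congr_of_eventuallyEq ?_ (hf_eq s hsσ)
      filter_upwards [nhdsWithin_le_nhds (Iio_mem_nhds hsσ)] with r hr using hf_eq r hr
    · exact continuousWithinAt_const.congr (fun r hr => hf_zero r (hsσ.trans hr)) (hf_zero s hsσ)
  rw [← Set.Ici_inter_Iio, Set.inter_comm, ← Measure.restrict_restrict measurableSet_Iio,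
    ← lintegral_indicator measurableSet_Iio, ← hf]
  refine (tendsto_tsum_mul_setLIntegral_Ici (g := f) hC hf_le hf_zero hf_cont).congr' ?_
  filter_upwards [self_mem_nhdsWithin] with h (hh : 0 < h)
  have hlt (k : ℕ) : k ∈ Finset.range ⌈σ / h⌉₊ ↔ k * h < σ := by
    rw [Finset.mem_range, Nat.lt_ceil, lt_div_iff₀ hh]
  rw [tsum_eq_sum (s := Finset.range ⌈σ / h⌉₊) fun k hk => by
    rw [hf_zero _ (not_lt.1 (mt (hlt k).2 hk)), zero_mul]]
  exact Finset.sum_congr rfl fun k hk => by rw [hf_eq _ ((hlt k).1 hk)]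

end RiemannSum

section Paths

variable {Ω : Type*} {X : ℝ≥0 → Ω → ℕ∞} {n : ℕ} {ω : Ω}

theorem exists_first_exit {α : Type*} [LinearOrder α] [TopologicalSpace α] [ClosedIciTopology α]
    {y : ℝ≥0 → α} {a : α} (hy : ∀ t, ContinuousWithinAt y (Set.Ici t) t) (hexit : ∃ t, a ≤ y t) :
    ∃ σ, a ≤ y σ ∧ ∀ s < σ, y s < a := by
  set S := {t | a ≤ y t}
  have hbelow (s : ℝ≥0) (hs : s < sInf S) : y s < a :=
    not_le.1 fun h => (csInf_le' (s := S) h).not_gt hs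
  refine ⟨sInf S, not_lt.1 fun hlt => ?_, hbelow⟩
  have hfreq := mem_closure_iff_frequently.1 (csInf_mem_closure hexit (OrderBot.bddBelow S))
  obtain ⟨s, hs, hs_lt⟩ := (hfreq.and_eventually
    (eventually_nhdsWithin_iff.1 ((hy (sInf S)).eventually_lt_const hlt))).exists
  exact (hs_lt (csInf_le' hs)).not_ge hs

theorem occupationTime_coe (X : ℝ≥0 → Ω → ℕ∞) (i : ℕ) (σ : ℝ≥0) (ω : Ω) :
    occupationTime X i σ ω =
      ∫⁻ s in Set.Ico 0 (σ : ℝ), {s : ℝ | X s.toNNReal ω = i}.indicator 1 s := by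
  rw [occupationTime]
  congr 2
  ext s
  refine and_congr_right fun hs => ?_
  rw [← ENNReal.ofReal_coe_nnreal, ENNReal.ofReal_lt_ofReal_iff_of_nonneg hs]

theorem occupationTime_coe_lt_top (X : ℝ≥0 → Ω → ℕ∞) (i : ℕ) (σ : ℝ≥0) (ω : Ω) :
    occupationTime X i σ ω < ∞ := by
  rw [occupationTime_coe]
  calc ∫⁻ s in Set.Ico 0 (σ : ℝ), {s : ℝ | X s.toNNReal ω = i}.indicator 1 s
    _ ≤ ∫⁻ _ in Set.Ico 0 (σ : ℝ), 1 := lintegral_mono fun s => Set.indicator_le_self _ _ s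
    _ < ∞ := by simp

theorem tendsto_sum_occupationTime (hω : ∀ t, ContinuousWithinAt (X · ω) (Set.Ici t) t) (i : ℕ)
    (σ : ℝ≥0) :
    Tendsto (fun h : ℝ≥0 =>
        ∑ k ∈ Finset.range ⌈σ / h⌉₊, if X (k * h) ω = i then (h : ℝ≥0∞) else 0) (𝓝[>] 0)
      (𝓝 (occupationTime X i σ ω)) := by
  have hclopen : IsClopen {(i : ℕ∞)} :=
    ⟨isClosed_singleton, ENat.isOpen_singleton (ENat.natCast_ne_top i)⟩
  have hcont (s : ℝ) : ContinuousWithinAt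
      ({s : ℝ | X s.toNNReal ω = i}.indicator (1 : ℝ → ℝ≥0∞)) (Set.Ici s) s :=
    ((hclopen.continuous_indicator continuous_one).continuousAt.comp_continuousWithinAt
      (hω s.toNNReal)).comp continuous_real_toNNReal.continuousWithinAt
      fun _ hr => Real.toNNReal_mono hr
  rw [occupationTime_coe]
  refine ((tendsto_sum_mul_setLIntegral_Ico ENNReal.one_ne_top
    (fun s => Set.indicator_le_self _ _ s) fun s _ => hcont s).comp tendsto_coe_nhdsGT_zero).congr
    fun h => ?_
  have hceil : ⌈(σ : ℝ) / h⌉₊ = ⌈σ / h⌉₊ := Nat.ceil_congr fun m => by norm_cast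
  have htime (k : ℕ) : (k * h : ℝ).toNNReal = k * h := by
    rw [← NNReal.coe_natCast, ← NNReal.coe_mul, Real.toNNReal_coe]
  rw [Function.comp_apply, hceil]
  simp only [Set.indicator_apply, Set.mem_ofPred_eq, htime, Pi.one_apply, ite_mul, one_mul,
    zero_mul, ENNReal.ofReal_coe_nnreal]

theorem killedWeight_of_lt (d : Fin n → ℝ) (h : ℝ≥0) {a : ℕ∞} (ha : a < n) :
    killedWeight d h a = ENNReal.ofReal (Real.exp
      (-∑ i : Fin n, d i * (if a = (i : ℕ) then (h : ℝ≥0∞) else 0).toReal)) := by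
  obtain ⟨i, rfl⟩ := exists_fin_eq_of_lt ha
  rw [killedWeight_coe, Finset.sum_eq_single i]
  · simp
  · intro j _ hj
    rw [if_neg fun hij => hj (Fin.ext (Nat.cast_injective hij)).symm, ENNReal.toReal_zero, mul_zero]
  · simp

theorem gridWeight_of_lt (d : Fin n → ℝ) (h : ℝ≥0) {y : ℝ≥0 → ℕ∞} {M : ℕ}
    (hlt : ∀ k < M, y (k * h) < n) :
    gridWeight d h y M = ENNReal.ofReal (Real.exp (-∑ i : Fin n, d i *
      (∑ k ∈ Finset.range M, if y (k * h) = (i : ℕ) then (h : ℝ≥0∞) else 0).toReal)) := by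
  have hsum (i : Fin n) :
      (∑ k ∈ Finset.range M, if y (k * h) = (i : ℕ) then (h : ℝ≥0∞) else 0).toReal =
        ∑ k ∈ Finset.range M, (if y (k * h) = (i : ℕ) then (h : ℝ≥0∞) else 0).toReal :=
    ENNReal.toReal_sum fun k _ => by split_ifs <;> simp
  rw [gridWeight,
    Finset.prod_congr rfl fun k hk => killedWeight_of_lt d h (hlt k (Finset.mem_range.1 hk)),
    ← ENNReal.ofReal_prod_of_nonneg fun _ _ => (Real.exp_pos _).le, ← Real.exp_sum,
    Finset.sum_neg_distrib, Finset.sum_comm]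
  simp only [hsum, Finset.mul_sum]

/-- The event that `X` leaves `{0, …, n - 1}` at a finite time, and by a transition to `n`. -/
def exitsTo (X : ℝ≥0 → Ω → ℕ∞) (n : ℕ) : Set Ω :=
  {ω | ∃ σ : ℝ≥0, X σ ω = n ∧ ∀ s < σ, X s ω < n}

/-- The exponential of minus the occupation times of `0, …, n - 1` before the hitting time of `n`,
weighted by `d`. -/
noncomputable def occupationExp (X : ℝ≥0 → Ω → ℕ∞) (d : Fin n → ℝ) (ω : Ω) : ℝ :=
  Real.exp (-∑ i : Fin n, d i * (occupationTime X i (hittingTime X n ω) ω).toReal)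

/-- The restriction of `occupationExp X d` to the event `exitsTo X n`, which is the limit of
`gridFunctional d h` along the paths of `X` as `h` tends to zero. -/
noncomputable def exitFunctional (X : ℝ≥0 → Ω → ℕ∞) (d : Fin n → ℝ) : Ω → ℝ≥0∞ :=
  (exitsTo X n).indicator fun ω => ENNReal.ofReal (occupationExp X d ω)

theorem occupationExp_nonneg (X : ℝ≥0 → Ω → ℕ∞) (d : Fin n → ℝ) (ω : Ω) :
    0 ≤ occupationExp X d ω :=
  (Real.exp_pos _).le

theorem hittingTime_eq {σ : ℝ≥0} (hσ : X σ ω = n) (hlt : ∀ s < σ, X s ω < n) :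
    hittingTime X n ω = σ :=
  le_antisymm (iInf₂_le σ hσ) (le_iInf₂ fun t ht =>
    ENNReal.coe_le_coe.2 (not_lt.1 fun h => (hlt t h).ne ht))

theorem hittingTime_lt_top (hω : ω ∈ exitsTo X n) : hittingTime X n ω < ∞ := by
  obtain ⟨σ, hσ, hlt⟩ := hω
  rw [hittingTime_eq hσ hlt]
  exact ENNReal.coe_lt_top

theorem occupationTime_lt_top (hω : ω ∈ exitsTo X n) (i : ℕ) :
    occupationTime X i (hittingTime X n ω) ω < ∞ := by
  lift hittingTime X n ω to ℝ≥0 using (hittingTime_lt_top hω).ne with σ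
  exact occupationTime_coe_lt_top X i σ ω

theorem exitFunctional_le_one {d : Fin n → ℝ} (hd : ∀ i, 0 ≤ d i) (ω : Ω) :
    exitFunctional X d ω ≤ 1 := by
  refine Set.indicator_apply_le' (fun _ => ?_) fun _ => zero_le_one
  rw [occupationExp, ENNReal.ofReal_le_one, Real.exp_le_one_iff, neg_nonpos]
  exact Finset.sum_nonneg fun i _ => mul_nonneg (hd i) ENNReal.toReal_nonneg

theorem tendsto_gridFunctional_of_exit (hω : ∀ t, ContinuousWithinAt (X · ω) (Set.Ici t) t)
    (d : Fin n → ℝ) {σ : ℝ≥0} (hσ : X σ ω = n) (hlt : ∀ s < σ, X s ω < n) :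
    Tendsto (fun h => gridFunctional d h (X · ω)) (𝓝[>] 0)
      (𝓝 (ENNReal.ofReal (occupationExp X d ω))) := by
  have hopen : {(n : ℕ∞)} ∈ 𝓝 (X σ ω) :=
    hσ ▸ (ENat.isOpen_singleton (ENat.natCast_ne_top n)).mem_nhds rfl
  have hgrid : ∀ᶠ h : ℝ≥0 in 𝓝[>] 0, ENNReal.ofReal (Real.exp (-∑ i : Fin n, d i *
      (∑ k ∈ Finset.range ⌈σ / h⌉₊,
        if X (k * h) ω = (i : ℕ) then (h : ℝ≥0∞) else 0).toReal)) =
      gridFunctional d h (X · ω) := by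
    filter_upwards [(tendsto_ceil_div_mul (t := σ) zero_le).eventually (hω σ hopen),
      self_mem_nhdsWithin] with h (hexit : X (⌈σ / h⌉₊ * h) ω = n) (hh : 0 < h)
    have hlt_grid (k : ℕ) (hk : k < ⌈σ / h⌉₊) : X (k * h) ω < n :=
      hlt _ ((lt_div_iff₀ hh).1 (Nat.lt_ceil.1 hk))
    rw [gridFunctional_eq_ite_of_exit hlt_grid hexit.ge, if_pos hexit,
      gridWeight_of_lt d h hlt_grid]
  rw [occupationExp, hittingTime_eq hσ hlt]
  refine Tendsto.congr' hgrid ((ENNReal.continuous_ofReal.tendsto _).comp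
    ((Real.continuous_exp.tendsto _).comp (tendsto_finsetSum _ fun i _ => ?_).neg))
  exact ((ENNReal.tendsto_toReal (occupationTime_coe_lt_top X i σ ω).ne).comp
    (tendsto_sum_occupationTime hω i σ)).const_mul _

theorem eventually_gridFunctional_eq_zero (hω : ∀ t, ContinuousWithinAt (X · ω) (Set.Ici t) t)
    (d : Fin n → ℝ) {σ : ℝ≥0} (hσ : n < X σ ω) (hlt : ∀ s < σ, X s ω < n) :
    ∀ᶠ h in 𝓝[>] 0, gridFunctional d h (X · ω) = 0 := by
  filter_upwards [(tendsto_ceil_div_mul (t := σ) zero_le).eventually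
    ((hω σ).eventually_const_lt hσ), self_mem_nhdsWithin]
    with h (hexit : n < X (⌈σ / h⌉₊ * h) ω) (hh : 0 < h)
  have hlt_grid (k : ℕ) (hk : k < ⌈σ / h⌉₊) : X (k * h) ω < n :=
    hlt _ ((lt_div_iff₀ hh).1 (Nat.lt_ceil.1 hk))
  rw [gridFunctional_eq_ite_of_exit hlt_grid hexit.le, if_neg hexit.ne']

theorem tendsto_gridFunctional (hω : ∀ t, ContinuousWithinAt (X · ω) (Set.Ici t) t)
    (d : Fin n → ℝ) :
    Tendsto (fun h => gridFunctional d h (X · ω)) (𝓝[>] 0) (𝓝 (exitFunctional X d ω)) := by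
  by_cases hmem : ω ∈ exitsTo X n
  · rw [exitFunctional, Set.indicator_of_mem hmem]
    obtain ⟨σ, hσ, hlt⟩ := hmem
    exact tendsto_gridFunctional_of_exit hω d hσ hlt
  · rw [exitFunctional, Set.indicator_of_notMem hmem]
    refine tendsto_nhds_of_eventually_eq ?_
    by_cases hexit : ∃ t, (n : ℕ∞) ≤ X t ω
    · obtain ⟨σ, hσ, hlt⟩ := exists_first_exit hω hexit
      have hσn : n < X σ ω := lt_of_le_of_ne hσ fun h => hmem ⟨σ, h.symm, hlt⟩
      exact eventually_gridFunctional_eq_zero hω d hσn hlt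
    · push Not at hexit
      exact Eventually.of_forall fun h => gridFunctional_eq_zero hexit

end Paths

section Limit

variable {Ω : Type*} [MeasurableSpace Ω] {μ : Measure Ω} {X : ℝ≥0 → Ω → ℕ∞}
  {Q : Matrix ℕ ℕ ℝ} {n : ℕ}

theorem aemeasurable_exitFunctional (hX : ∀ t, Measurable (X t))
    (hright : ∀ᵐ ω ∂μ, ∀ t, ContinuousWithinAt (X · ω) (Set.Ici t) t) (d : Fin n → ℝ) :
    AEMeasurable (exitFunctional X d) μ := by
  refine aemeasurable_of_tendsto_metrizable_ae (𝓝[>] (0 : ℝ≥0))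
    (fun h => (measurable_gridFunctional hX d h).aemeasurable) ?_
  filter_upwards [hright] with ω hω using tendsto_gridFunctional hω d

theorem tendsto_lintegral_gridFunctional [IsFiniteMeasure μ] (hX : ∀ t, Measurable (X t))
    (hright : ∀ᵐ ω ∂μ, ∀ t, ContinuousWithinAt (X · ω) (Set.Ici t) t) {d : Fin n → ℝ}
    (hd : ∀ i, 0 ≤ d i) :
    Tendsto (fun h => ∫⁻ ω, gridFunctional d h (X · ω) ∂μ) (𝓝[>] 0)
      (𝓝 (∫⁻ ω, exitFunctional X d ω ∂μ)) := by
  refine tendsto_lintegral_filter_of_dominated_convergence (fun _ => 1)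
    (Eventually.of_forall fun h => measurable_gridFunctional hX d h)
    (Eventually.of_forall fun h => Eventually.of_forall fun ω => gridFunctional_le_one hd)
    (by simp) ?_
  filter_upwards [hright] with ω hω using tendsto_gridFunctional hω d

theorem lintegral_exitFunctional_ne_top [IsFiniteMeasure μ] {d : Fin n → ℝ}
    (hd : ∀ i, 0 ≤ d i) : ∫⁻ ω, exitFunctional X d ω ∂μ ≠ ∞ :=
  ((lintegral_mono (exitFunctional_le_one hd)).trans_lt (by simp)).ne

theorem ofReal_occupationExp_ae_eq (hexit : ∀ᵐ ω ∂μ, ω ∈ exitsTo X n) (d : Fin n → ℝ) :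
    (fun ω => ENNReal.ofReal (occupationExp X d ω)) =ᵐ[μ] exitFunctional X d := by
  filter_upwards [hexit] with ω hω using
    (Set.indicator_of_mem hω fun ω => ENNReal.ofReal (occupationExp X d ω)).symm

theorem integrable_occupationExp [IsFiniteMeasure μ] (hX : ∀ t, Measurable (X t))
    (hright : ∀ᵐ ω ∂μ, ∀ t, ContinuousWithinAt (X · ω) (Set.Ici t) t)
    (hexit : ∀ᵐ ω ∂μ, ω ∈ exitsTo X n) {d : Fin n → ℝ} (hd : ∀ i, 0 ≤ d i) :
    Integrable (occupationExp X d) μ := by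
  refine (integrable_toReal_of_lintegral_ne_top (aemeasurable_exitFunctional hX hright d)
    (lintegral_exitFunctional_ne_top hd)).congr ?_
  filter_upwards [ofReal_occupationExp_ae_eq hexit d] with ω hω
  rw [← hω, ENNReal.toReal_ofReal (occupationExp_nonneg X d ω)]

theorem integral_occupationExp [IsFiniteMeasure μ] (hX : ∀ t, Measurable (X t))
    (hright : ∀ᵐ ω ∂μ, ∀ t, ContinuousWithinAt (X · ω) (Set.Ici t) t)
    (hexit : ∀ᵐ ω ∂μ, ω ∈ exitsTo X n) {d : Fin n → ℝ} (hd : ∀ i, 0 ≤ d i) :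
    ∫ ω, occupationExp X d ω ∂μ = (∫⁻ ω, exitFunctional X d ω ∂μ).toReal := by
  rw [integral_eq_lintegral_of_nonneg_ae (Eventually.of_forall (occupationExp_nonneg X d))
    (integrable_occupationExp hX hright hexit hd).aestronglyMeasurable,
    lintegral_congr_ae (ofReal_occupationExp_ae_eq hexit d)]

variable [IsProbabilityMeasure μ] {x : Fin n}

theorem IsMarkovProcess.det_mul_lintegral_exitFunctional (hX : IsMarkovProcess μ X Q x)
    {d : Fin n → ℝ} (hd : ∀ i, 0 ≤ d i) :
    (Matrix.diagonal d - upperBlock Q n).det * (∫⁻ ω, exitFunctional X d ω ∂μ).toReal =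
      (Matrix.diagonal d - upperBlock Q n).cramer (exitRate Q n) x := by
  obtain ⟨P, hP, hM⟩ := hX.markov
  refine det_mul_eq_cramer_of_tendsto_tsum hP hd ?_
  refine ((ENNReal.tendsto_toReal (lintegral_exitFunctional_ne_top hd)).comp
    (tendsto_lintegral_gridFunctional hX.measurable hX.rightContinuous hd)).congr fun h => ?_
  exact MarkovProperty.toReal_lintegral_gridFunctional hM hP hX.measurable hX.start d h

theorem IsMarkovProcess.lintegral_exitFunctional_zero (hX : IsMarkovProcess μ X Q x)
    (hQ : IsSkipFree Q) : ∫⁻ ω, exitFunctional X (0 : Fin n → ℝ) ω ∂μ = 1 := by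
  have hdet := hX.det_mul_lintegral_exitFunctional (d := (0 : Fin n → ℝ)) fun _ => le_rfl
  rwa [Matrix.diagonal_zero', zero_sub, hQ.cramer_neg_upperBlock,
    mul_eq_left₀ (hQ.det_neg_upperBlock_pos n).ne', ENNReal.toReal_eq_one_iff] at hdet

theorem IsMarkovProcess.ae_mem_exitsTo {x : ℕ} (hX : IsMarkovProcess μ X Q x) (hQ : IsSkipFree Q)
    (hx : x ≤ n) : ∀ᵐ ω ∂μ, ω ∈ exitsTo X n := by
  rcases hx.eq_or_lt with rfl | hlt
  · filter_upwards [hX.start] with ω hω using ⟨0, hω, fun s hs => absurd hs not_lt_zero⟩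
  have hone := IsMarkovProcess.lintegral_exitFunctional_zero (x := ⟨x, hlt⟩) hX hQ
  have hae : exitFunctional X (0 : Fin n → ℝ) =ᵐ[μ] fun _ => 1 :=
    ae_eq_of_ae_le_of_lintegral_le (Eventually.of_forall (exitFunctional_le_one fun _ => le_rfl))
      (by simp [hone]) aemeasurable_const (by simp [hone])
  filter_upwards [hae] with ω hω
  exact Set.mem_of_indicator_ne_zero (hω.trans_ne one_ne_zero)

end Limit

end SkipFree

theorem mainTheorem1 {Ω : Type*} [MeasurableSpace Ω] (μ : Measure Ω) [IsProbabilityMeasure μ]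
    (X : ℝ≥0 → Ω → ℕ∞) (Q : Matrix ℕ ℕ ℝ) (hQ : SkipFree.IsSkipFree Q)
    (hX : SkipFree.IsMarkovProcess μ X Q 0)
    (n : ℕ) (d : Fin n → ℝ) (hd : ∀ i, 0 ≤ d i) :
    (∀ᵐ ω ∂μ, SkipFree.hittingTime X n ω < ∞) ∧
    (∀ᵐ ω ∂μ, ∀ i : Fin n,
      SkipFree.occupationTime X i (SkipFree.hittingTime X n ω) ω < ∞) ∧
    Integrable (fun ω => Real.exp (-∑ i : Fin n, d i *
      (SkipFree.occupationTime X i (SkipFree.hittingTime X n ω) ω).toReal)) μ ∧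
    (Matrix.diagonal d - SkipFree.upperBlock Q n).det ≠ 0 ∧
    ∫ ω, Real.exp (-∑ i : Fin n, d i *
      (SkipFree.occupationTime X i (SkipFree.hittingTime X n ω) ω).toReal) ∂μ =
      (-SkipFree.upperBlock Q n).det /
        (Matrix.diagonal d - SkipFree.upperBlock Q n).det := by
  have hexit := hX.ae_mem_exitsTo hQ n.zero_le
  have hint := SkipFree.integrable_occupationExp hX.measurable hX.rightContinuous hexit hd
  have hdet : (Matrix.diagonal d - SkipFree.upperBlock Q n).det *
      ∫ ω, SkipFree.occupationExp X d ω ∂μ = (-SkipFree.upperBlock Q n).det := by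
    rcases n with _ | N
    · simp [SkipFree.occupationExp]
    rw [SkipFree.integral_occupationExp hX.measurable hX.rightContinuous hexit hd,
      SkipFree.IsMarkovProcess.det_mul_lintegral_exitFunctional (x := 0) hX hd,
      hQ.cramer_diagonal_sub_upperBlock_zero, hQ.det_neg_upperBlock]
  have hne : (Matrix.diagonal d - SkipFree.upperBlock Q n).det ≠ 0 :=
    left_ne_zero_of_mul (hdet.trans_ne (hQ.det_neg_upperBlock_pos n).ne')
  exact ⟨hexit.mono fun _ => SkipFree.hittingTime_lt_top,
    hexit.mono fun _ hω i => SkipFree.occupationTime_lt_top hω i, hint, hne,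
    eq_div_of_mul_eq hne ((mul_comm _ _).trans hdet)⟩
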